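/- Let $N=(N(t))_{t\ge 0}$ be a Poisson process with rate $\lambda>0$. For a positive integer $q$ let $\tau_q=\inf\{t\ge 0: N(t)\ge q\}$ be the first time at which $q$ orders have arrived. For a random time $\sigma$ that is almost surely finite, the cumulative squared waiting in a consolidation cycle $[0,\sigma]$ is $\int_0^{\sigma}(\sigma-t)^2\,dN(t)$, a Lebesgue--Stieltjes integral along the path of $N$; write $W'_{HP}(q,T)$, $W'_{QP}(q)$, $W'_{TP}(T)$ for this quantity with $\sigma=\tau_q\wedge T$ (hybrid policy with parameters $q$ and $T$), $\sigma=\tau_q$ (quantity-based policy with parameter $q$) and $\sigma=T$ (time-based policy with parameter $T$), respectively. Let $q\ge 1$ be an integer, let $T>0$, let $Y\sim\mathrm{Poisson}(\lambda T)$, and put $Y_{m}=\min(Y,m)$. Then $\tau_q<\infty$ almost surely, the three random variables $W'_{HP}(q,T)$, $W'_{QP}(q)$, $W'_{TP}(T)$ are integrable, and $$\mathbb{E}[W'_{HP}(q,T)]=\mathbb{E}\left[\int_0^{\tau_q\wedge T}(\tau_q\wedge T-t)^2\,dN(t)\right]=\frac{\mathbb{E}\left[Y_{q+1}(Y_{q+1}-1)(Y_{q+1}-2)\right]}{3\lambda^2},$$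 $$\mathbb{E}[W'_{QP}(q)]=\lim_{S\to\infty}\mathbb{E}[W'_{HP}(q,S)]=\frac{q^3-q}{3\lambda^2},$$ $$\mathbb{E}[W'_{TP}(T)]=\lim_{k\to\infty}\mathbb{E}[W'_{HP}(k,T)]=\frac{\mathbb{E}[Y(Y-1)(Y-2)]}{3\lambda^2}=\frac{\lambda T^3}{3}.$$ -/

import Mathlib

open MeasureTheory ProbabilityTheory Filter Topology
open scoped NNReal

noncomputable section

namespace Consolidation

/-- A path of a counting process: it starts at `0`, is nondecreasing and right-continuous, and
takes values in `ℕ`. -/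
structure IsCountingPath (n : ℝ≥0 → ℕ) : Prop where
  zero : n 0 = 0
  mono : Monotone n
  right_continuous : ∀ t, ContinuousWithinAt n (Set.Ici t) t

/-- `N` is a (homogeneous) Poisson process with rate `lam` under `P`: a counting process with
independent increments such that `N t - N s` is Poisson distributed with mean `lam * (t - s)`
for all `s ≤ t`. (As the paths are nondecreasing, the differences in `ℕ` are true differences.) -/
structure IsPoissonProcess {Ω : Type*} [MeasurableSpace Ω] (N : ℝ≥0 → Ω → ℕ) (lam : ℝ≥0)
    (P : Measure Ω) : Prop where
  measurable : ∀ t, Measurable (N t)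
  path : ∀ ω, IsCountingPath (fun t => N t ω)
  indep_increments : HasIndepIncrements N P
  law_increments : ∀ s t, s ≤ t →
    HasLaw (fun ω => N t ω - N s ω) (poissonMeasure (lam * (t - s))) P

/-- A counting path as a Stieltjes function. -/
def IsCountingPath.stieltjes {n : ℝ≥0 → ℕ} (h : IsCountingPath n) : StieltjesFunction ℝ≥0 where
  toFun t := (n t : ℝ)
  mono' _ _ hst := Nat.cast_le.2 (h.mono hst)
  right_continuous' t :=
    (continuous_of_discreteTopology (f := (Nat.cast : ℕ → ℝ))).continuousAt.comp_continuousWithinAt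
      (h.right_continuous t)

/-- The random measure `dN(t)` on the time axis: the Lebesgue-Stieltjes measure of the path. -/
def arrivalMeasure {Ω : Type*} {N : ℝ≥0 → Ω → ℕ} (hN : ∀ ω, IsCountingPath (fun t => N t ω))
    (ω : Ω) : Measure ℝ≥0 :=
  (hN ω).stieltjes.measure

/-- `τ_q`, the first time at which the number of arrivals reaches `q` (`⊤` if it never does). -/
def hittingTime {Ω : Type*} (N : ℝ≥0 → Ω → ℕ) (q : ℕ) : Ω → WithTop ℝ≥0 :=
  hittingAfter N (Set.Ici q) 0

/-- Length of a consolidation cycle under the hybrid policy: `τ_q ∧ T`. -/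
def cycleHP {Ω : Type*} (N : ℝ≥0 → Ω → ℕ) (q : ℕ) (T : ℝ≥0) : Ω → WithTop ℝ≥0 :=
  fun ω => min (hittingTime N q ω) (T : WithTop ℝ≥0)

/-- Length of a consolidation cycle under the quantity-based policy: `τ_q`. -/
def cycleQP {Ω : Type*} (N : ℝ≥0 → Ω → ℕ) (q : ℕ) : Ω → WithTop ℝ≥0 :=
  hittingTime N q

/-- Length of a consolidation cycle under the time-based policy: `T`. -/
def cycleTP {Ω : Type*} (T : ℝ≥0) : Ω → WithTop ℝ≥0 :=
  fun _ => (T : WithTop ℝ≥0)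

/-- Cumulative squared waiting `∫_0^σ (σ - t)² dN(t)` in a cycle of length `σ`
(only meaningful where `σ` is finite). -/
def squaredWaiting {Ω : Type*} {N : ℝ≥0 → Ω → ℕ} (hN : ∀ ω, IsCountingPath (fun t => N t ω))
    (σ : Ω → WithTop ℝ≥0) (ω : Ω) : ℝ :=
  ∫ t in Set.Ioc 0 (σ ω).untopA, (((σ ω).untopA : ℝ) - (t : ℝ)) ^ 2 ∂(arrivalMeasure hN ω)

/-- The truncated random variable `X_q = min(X, q)`. -/
def truncated {Ω : Type*} (X : Ω → ℕ) (q : ℕ) (ω : Ω) : ℕ := min (X ω) q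

/-- `n (n - 1) (n - 2)` as a real number. -/
def fallingThree (n : ℕ) : ℝ := (n : ℝ) * ((n : ℝ) - 1) * ((n : ℝ) - 2)

end Consolidation

end

open scoped ENNReal

noncomputable section

namespace Consolidation

/-! Write `(σ - t)²` as the integral of `2` over `t ≤ s < u < σ` and exchange it with `dN(t)`: the
squared waiting becomes `2 ∬ N(s) ds du` over `s < u < σ`. By right-continuity `u < τ_q` means `N(u)
< q`, so each policy only restricts `u` to a fixed set `I` and `N(u)` to a set `B`
(`doubleWaiting`).

For `s ≤ u`, independence of increments and the Chen-Stein identity give `E[N(s) g(N(u))] = λ s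
E[g(N(u) + 1)]` (`IsPoissonProcess.lintegral_mul`). Integrating over `s < u`, the mean is `∫_I λ u²
P(N(u) + 1 ∈ B) du`. When `B = {n < q}`, Chen-Stein read backwards twice turns the integrand into
`λ⁻¹ ∑_{n ≤ q} n (n - 1) P(N(u) = n)`. The mean time spent at level `n` before `T` is `λ⁻¹ P(N(T) >
n)`, or `λ⁻¹` over the whole axis. The sum `3 ∑_{n ≤ q} n (n - 1) 1{Y > n}` telescopes to the
falling factorial of `min(Y, q + 1)`, which explains the shift to `q + 1`. -/

/-! ### Lebesgue measure on the time axis -/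

/-- Lebesgue measure on `ℝ≥0`. -/
def timeMeasure : Measure ℝ≥0 := Measure.map Real.toNNReal (volume.restrict (Set.Ici 0))

instance : SFinite timeMeasure := by
  unfold timeMeasure; infer_instance

lemma setLIntegral_Ico_timeMeasure (a b : ℝ≥0) {f F : ℝ → ℝ} (hf : Continuous f)
    (hF : ∀ x, HasDerivAt F (f x) x) (hab : a ≤ b) (h0 : ∀ x, (a : ℝ) ≤ x → 0 ≤ f x) :
    ∫⁻ s in Set.Ico a b, ENNReal.ofReal (f s) ∂timeMeasure = ENNReal.ofReal (F b - F a) := by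
  have hmeas : Measurable fun s : ℝ≥0 => ENNReal.ofReal (f s) := by
    have := hf.measurable
    fun_prop
  have hpre : Real.toNNReal ⁻¹' Set.Ico a b ∩ Set.Ici 0 = Set.Ico (a : ℝ) b := by
    ext x
    simp only [Set.mem_inter_iff, Set.mem_preimage, Set.mem_Ico, Set.mem_Ici]
    constructor
    · rintro ⟨⟨h1, h2⟩, h3⟩
      lift x to ℝ≥0 using h3
      simp only [Real.toNNReal_coe] at h1 h2
      exact_mod_cast And.intro h1 h2
    · rintro ⟨h1, h2⟩
      have h3 : 0 ≤ x := a.2.trans h1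
      lift x to ℝ≥0 using h3
      simp only [Real.toNNReal_coe]
      exact_mod_cast And.intro (And.intro h1 h2) x.2
  rw [timeMeasure, setLIntegral_map measurableSet_Ico hmeas measurable_real_toNNReal,
    Measure.restrict_restrict (measurable_real_toNNReal measurableSet_Ico), hpre]
  have hab' : (a : ℝ) ≤ b := by exact_mod_cast hab
  have hint := hf.intervalIntegrable (μ := volume) (a : ℝ) b
  rw [← intervalIntegral.integral_eq_sub_of_hasDerivAt (fun x _ => hF x) hint,
    intervalIntegral.integral_of_le hab', ← integral_Ico_eq_integral_Ioc,
    ofReal_integral_eq_lintegral_ofReal]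
  · refine setLIntegral_congr_fun measurableSet_Ico fun x hx => ?_
    simp only [Real.coe_toNNReal x (a.2.trans hx.1)]
  · rw [intervalIntegrable_iff_integrableOn_Ioc_of_le hab'] at hint
    exact hint.congr_set_ae Ico_ae_eq_Ioc
  · filter_upwards [ae_restrict_mem measurableSet_Ico] with x hx using h0 x hx.1

lemma timeMeasure_Ico (a b : ℝ≥0) :
    timeMeasure (Set.Ico a b) = ENNReal.ofReal ((b : ℝ) - a) := by
  rcases le_total a b with hab | hab
  · have h := setLIntegral_Ico_timeMeasure a b (f := fun _ => 1) (F := fun x => x)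
      continuous_const (fun x => hasDerivAt_id x) hab (fun _ _ => zero_le_one)
    simpa using h
  · rw [Set.Ico_eq_empty (not_lt.2 hab), measure_empty, ENNReal.ofReal_of_nonpos]
    exact sub_nonpos.2 (by exact_mod_cast hab)

/-- The triangle `t ≤ s < u < σ` has area `(σ - t)² / 2`. In this form `t` enters only through `t ≤
s`, which integrates against `dN(t)` to `N(s)`. -/
lemma ofReal_sq_sub_eq_lintegral (t σ : ℝ≥0) (h : t ≤ σ) :
    ENNReal.ofReal (((σ : ℝ) - t) ^ 2) =
      ∫⁻ u in Set.Iio σ, ∫⁻ s in Set.Iio u, (Set.Ici t).indicator (fun _ => 2) s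
        ∂timeMeasure ∂timeMeasure := by
  have hin (u : ℝ≥0) : ∫⁻ s in Set.Iio u, (Set.Ici t).indicator (fun _ => 2) s ∂timeMeasure =
      (Set.Ici t).indicator (fun u => ENNReal.ofReal (2 * ((u : ℝ) - t))) u := by
    rw [lintegral_indicator_const measurableSet_Ici, Measure.restrict_apply measurableSet_Ici,
      Set.Ici_inter_Iio, timeMeasure_Ico, Set.indicator_apply]
    split_ifs with hu
    · rw [ENNReal.ofReal_mul zero_le_two, ENNReal.ofReal_ofNat]
    · rw [ENNReal.ofReal_of_nonpos, mul_zero]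
      exact sub_nonpos.2 (by exact_mod_cast (not_le.1 hu).le)
  simp_rw [hin]
  rw [lintegral_indicator measurableSet_Ici, Measure.restrict_restrict measurableSet_Ici,
    Set.Ici_inter_Iio, setLIntegral_Ico_timeMeasure t σ (f := fun u => 2 * (u - t))
      (F := fun u => (u - t) ^ 2) (by fun_prop) (fun x => ?_) h (fun x hx => by linarith)]
  · simp
  · simpa using! ((hasDerivAt_id x).sub_const (t : ℝ)).pow 2

/-! ### Squared waiting along a path -/

lemma IsCountingPath.measure_Ioc_zero {n : ℝ≥0 → ℕ} (hn : IsCountingPath n) (s : ℝ≥0) :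
    hn.stieltjes.measure (Set.Ioc 0 s) = n s := by
  have h : ∀ t, hn.stieltjes t = (n t : ℝ) := fun _ => rfl
  rw [StieltjesFunction.measure_Ioc, h, h, hn.zero]
  simp

lemma IsCountingPath.lintegral_sq_sub {n : ℝ≥0 → ℕ} (hn : IsCountingPath n) (σ : ℝ≥0) :
    ∫⁻ t in Set.Ioc 0 σ, ENNReal.ofReal (((σ : ℝ) - t) ^ 2) ∂hn.stieltjes.measure =
      ∫⁻ u in Set.Iio σ, ∫⁻ s in Set.Iio u, 2 * (n s : ℝ≥0∞) ∂timeMeasure ∂timeMeasure := by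
  rw [setLIntegral_congr_fun measurableSet_Ioc
    (fun t ht => ofReal_sq_sub_eq_lintegral t σ ht.2)]
  have hm : Measurable fun p : ℝ≥0 × ℝ≥0 => (Set.Ici p.1).indicator (fun _ => (2 : ℝ≥0∞)) p.2 := by
    have : (fun p : ℝ≥0 × ℝ≥0 => (Set.Ici p.1).indicator (fun _ => (2 : ℝ≥0∞)) p.2) =
        Set.indicator {p : ℝ≥0 × ℝ≥0 | p.1 ≤ p.2} (fun _ => 2) := by
      ext p; simp [Set.indicator_apply]
    rw [this]
    exact measurable_const.indicator (measurableSet_le measurable_fst measurable_snd)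
  -- The moving domain `s < u` is encoded as an indicator on the product, so that measurability of
  -- parameter integrals applies.
  have hm3 : Measurable fun q : (ℝ≥0 × ℝ≥0) × ℝ≥0 =>
      (Set.Iio q.1.2).indicator ((Set.Ici q.1.1).indicator (fun _ => (2 : ℝ≥0∞))) q.2 := by
    have : (fun q : (ℝ≥0 × ℝ≥0) × ℝ≥0 =>
        (Set.Iio q.1.2).indicator ((Set.Ici q.1.1).indicator (fun _ => (2 : ℝ≥0∞))) q.2) =
        Set.indicator {q : (ℝ≥0 × ℝ≥0) × ℝ≥0 | q.2 < q.1.2}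
          (fun q => (Set.Ici q.1.1).indicator (fun _ => (2 : ℝ≥0∞)) q.2) := by
      ext q; simp [Set.indicator_apply]
    rw [this]
    exact (hm.comp (measurable_fst.fst.prodMk measurable_snd)).indicator
      (measurableSet_lt measurable_snd measurable_fst.snd)
  rw [lintegral_lintegral_swap]
  · refine setLIntegral_congr_fun measurableSet_Iio fun u hu => ?_
    rw [lintegral_lintegral_swap hm.aemeasurable]
    refine setLIntegral_congr_fun measurableSet_Iio fun s hs => ?_
    have : (fun t : ℝ≥0 => (Set.Ici t).indicator (fun _ => (2 : ℝ≥0∞)) s) =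
        (Set.Iic s).indicator (fun _ => 2) := by
      ext t; simp [Set.indicator_apply]
    simp only [this]
    rw [lintegral_indicator_const measurableSet_Iic, Measure.restrict_apply measurableSet_Iic,
      ← hn.measure_Ioc_zero s]
    congr 2
    ext t
    simp only [Set.mem_inter_iff, Set.mem_Iic, Set.mem_Ioc]
    -- Since `s < u < σ`, the restriction of `t` to `(0, σ]` is inactive and the remaining mass is
    -- that of `(0, s]`.
    have : s < σ := lt_trans hs hu
    exact ⟨fun h => ⟨h.2.1, h.1⟩, fun h => ⟨h.2, h.1, h.2.trans this.le⟩⟩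
  · refine Measurable.aemeasurable ?_
    have := hm3.lintegral_prod_right' (ν := timeMeasure)
    simpa only [lintegral_indicator measurableSet_Iio, Function.uncurry_def] using this

lemma untopA_coe_eq (t : ℝ≥0) : (t : WithTop ℝ≥0).untopA = t := by
  rw [WithTop.untopA_eq_untop WithTop.coe_ne_top, WithTop.untop_coe]

/-- Finiteness of `σ ω` matters: at `⊤` the left side uses a default value of `untopA`, while the
right side integrates over the whole axis. -/
lemma squaredWaiting_eq_toReal {Ω : Type*} {N : ℝ≥0 → Ω → ℕ}
    (hN : ∀ ω, IsCountingPath (fun t => N t ω)) (σ : Ω → WithTop ℝ≥0) (ω : Ω) (h : σ ω ≠ ⊤) :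
    squaredWaiting hN σ ω =
      (∫⁻ u in {u : ℝ≥0 | (u : WithTop ℝ≥0) < σ ω},
        ∫⁻ s in Set.Iio u, 2 * (N s ω : ℝ≥0∞) ∂timeMeasure ∂timeMeasure).toReal := by
  obtain ⟨t, ht⟩ := WithTop.ne_top_iff_exists.1 h
  have hs : {u : ℝ≥0 | (u : WithTop ℝ≥0) < σ ω} = Set.Iio t := by
    ext u
    rw [Set.mem_ofPred_eq, ← ht, Set.mem_Iio]
    exact WithTop.coe_lt_coe
  rw [squaredWaiting, hs, ← (hN ω).lintegral_sq_sub, ← ht, untopA_coe_eq, arrivalMeasure,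
    integral_eq_lintegral_of_nonneg_ae (ae_of_all _ fun _ => sq_nonneg _)
      (by fun_prop)]

lemma IsCountingPath.lt_of_lt {n : ℝ≥0 → ℕ} (hn : IsCountingPath n) {u : ℝ≥0} {q : ℕ}
    (h : n u < q) : ∃ r, u < r ∧ n r < q := by
  have h1 : ∀ᶠ x in 𝓝[>] u, n x < q :=
    ((hn.right_continuous u).mono Set.Ioi_subset_Ici_self).eventually_lt_const h
  obtain ⟨r, hr⟩ := (h1.and self_mem_nhdsWithin).exists
  exact ⟨r, hr.2, hr.1⟩

/-- Right-continuity makes the inequality strict: a path below `q` at `u` is still below `q` at some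
later `r`, and by monotonicity `r` bounds every hitting point from below. -/
lemma coe_lt_hittingTime_iff {Ω : Type*} {N : ℝ≥0 → Ω → ℕ}
    (hN : ∀ ω, IsCountingPath (fun t => N t ω)) (q : ℕ) (ω : Ω) (u : ℝ≥0) :
    (u : WithTop ℝ≥0) < hittingTime N q ω ↔ N u ω < q := by
  constructor
  · intro h
    by_contra hu
    exact h.not_ge (hittingAfter_le_of_mem zero_le (not_lt.1 hu))
  · intro h
    obtain ⟨r, hur, hr⟩ := (hN ω).lt_of_lt h
    refine lt_of_lt_of_le (WithTop.coe_lt_coe.2 hur) ?_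
    simp only [hittingTime, hittingAfter]
    split_ifs with hex
    · refine WithTop.coe_le_coe.2 (le_csInf (by simpa [Set.Nonempty] using hex) ?_)
      rintro b ⟨-, hb⟩
      by_contra hbr
      exact absurd ((hN ω).mono (not_le.1 hbr).le) (not_le.2 (lt_of_lt_of_le hr hb))
    · exact le_top

/-! ### Poisson distributions -/

lemma lintegral_poissonMeasure (r : ℝ≥0) (f : ℕ → ℝ≥0∞) :
    ∫⁻ n, f n ∂poissonMeasure r = ∑' n, poissonMeasure r {n} * f n := by
  simp_rw [lintegral_countable', mul_comm]

lemma poissonMeasure_singleton_succ (r : ℝ≥0) (n : ℕ) :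
    poissonMeasure r {n + 1} * ((n + 1 : ℕ) : ℝ≥0∞) = r * poissonMeasure r {n} := by
  rw [poissonMeasure_singleton, poissonMeasure_singleton, ← ENNReal.ofReal_natCast,
    ← ENNReal.ofReal_coe_nnreal, ← ENNReal.ofReal_mul (by positivity),
    ← ENNReal.ofReal_mul (by positivity)]
  congr 1
  have : ((n + 1 : ℕ) : ℝ) ≠ 0 := by positivity
  have : (n.factorial : ℝ) ≠ 0 := by positivity
  rw [Nat.factorial_succ]
  push_cast
  field_simp
  ring

/-- The Chen-Stein identity for a Poisson distribution. -/
lemma lintegral_poissonMeasure_mul (r : ℝ≥0) (f : ℕ → ℝ≥0∞) :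
    ∫⁻ n, n * f n ∂poissonMeasure r = r * ∫⁻ n, f (n + 1) ∂poissonMeasure r := by
  rw [lintegral_poissonMeasure, lintegral_poissonMeasure,
    tsum_eq_zero_add' ENNReal.summable, ← ENNReal.tsum_mul_left]
  simp only [Nat.cast_zero, zero_mul, mul_zero, zero_add]
  refine tsum_congr fun n => ?_
  rw [← mul_assoc, poissonMeasure_singleton_succ, mul_assoc]

/-- The derivatives of the summands telescope, leaving only the last one. -/
lemma hasDerivAt_poisson_cdf (lam : ℝ) (n : ℕ) (x : ℝ) :
    HasDerivAt (fun x => -∑ i ∈ Finset.range (n + 1),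
        Real.exp (-(lam * x)) * (lam * x) ^ i / i.factorial)
      (lam * (Real.exp (-(lam * x)) * (lam * x) ^ n / n.factorial)) x := by
  have hl : HasDerivAt (fun x => lam * x) lam x := by
    simpa using (hasDerivAt_id x).const_mul lam
  have he : HasDerivAt (fun x => Real.exp (-(lam * x))) (Real.exp (-(lam * x)) * -lam) x :=
    hl.neg.exp
  induction n with
  | zero => simpa [mul_comm] using! he.neg
  | succ n ih =>
    have h := ih.sub ((he.mul (hl.pow (n + 1))).div_const ((n + 1).factorial : ℝ))
    refine (h.congr_deriv ?_).congr_of_eventuallyEq (Eventually.of_forall fun y => ?_)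
    · have : (n.factorial : ℝ) ≠ 0 := by positivity
      have : (n : ℝ) + 1 ≠ 0 := by positivity
      simp only [Pi.pow_apply, Nat.factorial_succ, Nat.add_sub_cancel]
      push_cast
      field_simp
      ring
    · simp only [Finset.sum_range_succ _ (n + 1), Pi.sub_apply, Pi.mul_apply, Pi.pow_apply]
      ring

lemma poissonMeasure_Ioi (r : ℝ≥0) (n : ℕ) :
    poissonMeasure r (Set.Ioi n) =
      ENNReal.ofReal (1 - ∑ i ∈ Finset.range (n + 1), Real.exp (-r) * r ^ i / i.factorial) := by
  have h : (Set.Ioi n) = ((Finset.range (n + 1) : Finset ℕ) : Set ℕ)ᶜ := by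
    ext k; simp
  rw [h, prob_compl_eq_one_sub (by measurability), ← sum_measure_singleton,
    ENNReal.ofReal_sub _ (Finset.sum_nonneg fun i _ => by positivity), ENNReal.ofReal_one,
    ENNReal.ofReal_sum_of_nonneg fun i _ => by positivity]
  simp_rw [poissonMeasure_singleton]

lemma setLIntegral_poissonMeasure_singleton {lam : ℝ≥0} (hlam : 0 < lam) (T : ℝ≥0) (n : ℕ) :
    ∫⁻ u in Set.Iio T, poissonMeasure (lam * u) {n} ∂timeMeasure =
      (lam : ℝ≥0∞)⁻¹ * poissonMeasure (lam * T) (Set.Ioi n) := by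
  have h := setLIntegral_Ico_timeMeasure 0 T
    (f := fun x => lam * (Real.exp (-(lam * x)) * (lam * x) ^ n / n.factorial)) (by fun_prop)
    (fun x => hasDerivAt_poisson_cdf lam n x) zero_le (fun x hx => by
      have : 0 ≤ x := hx
      positivity)
  -- At time `0` only the term `i = 0` survives, with `0 ^ 0 = 1`.
  have h0 : ∑ i ∈ Finset.range (n + 1),
      Real.exp (-((lam : ℝ) * (0 : ℝ≥0))) * ((lam : ℝ) * (0 : ℝ≥0)) ^ i / i.factorial = 1 := by
    simp [Finset.sum_range_succ']
  have hI : Set.Ico 0 T = Set.Iio T := by ext; simp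
  have hl : (lam : ℝ≥0∞) ≠ 0 := by exact_mod_cast hlam.ne'
  rw [h0, hI, sub_neg_eq_add, neg_add_eq_sub] at h
  rw [poissonMeasure_Ioi, NNReal.coe_mul, ← h, ← lintegral_const_mul' _ _ (by simp [hl])]
  refine lintegral_congr fun u => ?_
  rw [poissonMeasure_singleton, ENNReal.ofReal_mul (p := (lam : ℝ)) lam.2,
    ENNReal.ofReal_coe_nnreal, ← mul_assoc,
    ENNReal.inv_mul_cancel hl ENNReal.coe_ne_top, one_mul, NNReal.coe_mul]

lemma tendsto_poissonMeasure_Ioi {lam : ℝ≥0} (hlam : 0 < lam) (n : ℕ) :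
    Tendsto (fun S : ℝ≥0 => poissonMeasure (lam * S) (Set.Ioi n)) atTop (𝓝 1) := by
  simp_rw [poissonMeasure_Ioi]
  rw [← ENNReal.ofReal_one]
  refine ENNReal.tendsto_ofReal ?_
  have hS : Tendsto (fun S : ℝ≥0 => ((lam * S : ℝ≥0) : ℝ)) atTop atTop := by
    have : Tendsto (fun S : ℝ≥0 => (S : ℝ)) atTop atTop := NNReal.tendsto_coe_atTop.2 tendsto_id
    simpa using this.const_mul_atTop (show (0 : ℝ) < lam from hlam)
  have hi (i : ℕ) : Tendsto (fun x : ℝ => Real.exp (-x) * x ^ i / i.factorial) atTop (𝓝 0) := by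
    have := (Real.tendsto_pow_mul_exp_neg_atTop_nhds_zero i).div_const (i.factorial : ℝ)
    simpa [mul_comm] using this
  have := (tendsto_finsetSum (Finset.range (n + 1)) fun i _ => (hi i).comp hS).const_sub 1
  simpa using this

lemma lintegral_poissonMeasure_singleton {lam : ℝ≥0} (hlam : 0 < lam) (n : ℕ) :
    ∫⁻ u, poissonMeasure (lam * u) {n} ∂timeMeasure = (lam : ℝ≥0∞)⁻¹ := by
  have hmono : Monotone fun k : ℕ => Set.Iio (k : ℝ≥0) := fun a b hab =>
    Set.Iio_subset_Iio (by exact_mod_cast hab)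
  have hU : ⋃ k : ℕ, Set.Iio (k : ℝ≥0) = Set.univ := by
    refine Set.eq_univ_of_forall fun x => Set.mem_iUnion.2 ?_
    obtain ⟨k, hk⟩ := exists_nat_gt x
    exact ⟨k, hk⟩
  have hl : (lam : ℝ≥0∞) ≠ 0 := by exact_mod_cast hlam.ne'
  rw [← setLIntegral_univ, ← hU]
  -- Viewing the integrand as a density turns the limit `T → ∞` into continuity from below of a
  -- measure.
  have h1 := tendsto_measure_iUnion_atTop hmono
    (μ := timeMeasure.withDensity fun u => poissonMeasure (lam * u) {n})
  simp only [Function.comp_def, withDensity_apply'] at h1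
  refine tendsto_nhds_unique h1 ?_
  simp_rw [setLIntegral_poissonMeasure_singleton hlam]
  have h2 := ENNReal.Tendsto.const_mul (a := (lam : ℝ≥0∞)⁻¹)
    ((tendsto_poissonMeasure_Ioi hlam n).comp (tendsto_natCast_atTop_atTop (R := ℝ≥0)))
    (Or.inl one_ne_zero)
  simpa using h2

/-! ### Moments of the process -/

/-- The waiting functional `2 ∬ N(s) ds du` over the region `s < u`, with `u ∈ I`
and `N(u) ∈ B`. -/
def doubleWaiting {Ω : Type*} (N : ℝ≥0 → Ω → ℕ) (I : Set ℝ≥0) (B : Set ℕ) (ω : Ω) : ℝ≥0∞ :=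
  ∫⁻ u in I, ∫⁻ s in Set.Iio u, 2 * ((N s ω : ℝ≥0∞) * B.indicator 1 (N u ω))
    ∂timeMeasure ∂timeMeasure

variable {Ω : Type*} [MeasurableSpace Ω] {P : Measure Ω} {N : ℝ≥0 → Ω → ℕ} {lam : ℝ≥0}

lemma IsPoissonProcess.hasLaw (hN : IsPoissonProcess N lam P) (t : ℝ≥0) :
    HasLaw (N t) (poissonMeasure (lam * t)) P := by
  have h := hN.law_increments 0 t zero_le
  have h0 (ω : Ω) : N 0 ω = 0 := (hN.path ω).zero
  simpa [h0] using h

/-- By right-continuity and monotonicity, `N(u) < q` holds iff `N(r) < q` for some `r > u` in a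
countable dense set. -/
lemma IsPoissonProcess.measurable_uncurry (hN : IsPoissonProcess N lam P) :
    Measurable fun p : ℝ≥0 × Ω => N p.1 p.2 := by
  obtain ⟨D, hDc, hD⟩ := TopologicalSpace.exists_countable_dense ℝ≥0
  refine measurable_of_Iio fun q => ?_
  have : (fun p : ℝ≥0 × Ω => N p.1 p.2) ⁻¹' Set.Iio q =
      ⋃ r ∈ D, Set.Iio r ×ˢ {ω | N r ω < q} := by
    ext ⟨u, ω⟩
    simp only [Set.mem_preimage, Set.mem_Iio, Set.mem_iUnion, Set.mem_prod, Set.mem_ofPred_eq,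
      exists_prop]
    constructor
    · intro h
      obtain ⟨r, hur, hr⟩ := (hN.path ω).lt_of_lt h
      obtain ⟨d, hd, hud, hdr⟩ := hD.exists_between hur
      exact ⟨d, hd, hud, ((hN.path ω).mono hdr.le).trans_lt hr⟩
    · rintro ⟨r, -, hur, hr⟩
      exact ((hN.path ω).mono hur.le).trans_lt hr
  rw [this]
  exact MeasurableSet.biUnion hDc fun r _ =>
    measurableSet_Iio.prod (hN.measurable r measurableSet_Iio)

/-- Freeze the increment `y = N(u) - N(s)`, which is independent of `N(s)`, and apply Chen-Stein to
`x ↦ g(x + y)` under the law of `N(s)`. -/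
lemma IsPoissonProcess.lintegral_mul [IsProbabilityMeasure P] (hN : IsPoissonProcess N lam P)
    {s u : ℝ≥0} (hsu : s ≤ u) (g : ℕ → ℝ≥0∞) :
    ∫⁻ ω, (N s ω : ℝ≥0∞) * g (N u ω) ∂P =
      (lam * s : ℝ≥0) * ∫⁻ n, g (n + 1) ∂poissonMeasure (lam * u) := by
  have hind : IndepFun (N s) (fun ω => N u ω - N s ω) P := by
    have h := hN.indep_increments.indepFun_sub_sub (r := 0) zero_le hsu
    have h0 : N s - N 0 = N s := by
      ext ω
      simp [show N 0 ω = 0 from (hN.path ω).zero]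
    rwa [h0] at h
  have hlaw := (indepFun_iff_hasLaw_prodMk_prod (hN.hasLaw s) (hN.law_increments s u hsu)).1 hind
  have hadd (ω : Ω) : N s ω + (N u ω - N s ω) = N u ω :=
    Nat.add_sub_cancel' ((hN.path ω).mono hsu)
  have key (h : ℕ × ℕ → ℝ≥0∞) : ∫⁻ ω, h (N s ω, N u ω - N s ω) ∂P =
      ∫⁻ y, ∫⁻ x, h (x, y) ∂poissonMeasure (lam * s) ∂poissonMeasure (lam * (u - s)) := by
    rw [hlaw.lintegral_comp (f := h) (measurable_of_countable h).aemeasurable,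
      lintegral_prod_symm _ (measurable_of_countable h).aemeasurable]
  have h1 := key fun p => p.1 * g (p.1 + p.2)
  have h2 := key fun p => g (p.1 + p.2 + 1)
  simp only [hadd] at h1 h2
  rw [h1, ← (hN.hasLaw u).lintegral_comp (f := fun n => g (n + 1))
    (measurable_of_countable _).aemeasurable, h2, ← lintegral_const_mul' _ _ ENNReal.coe_ne_top]
  refine lintegral_congr fun y => ?_
  rw [lintegral_poissonMeasure_mul _ fun x => g (x + y)]
  simp only [add_right_comm]

lemma IsPoissonProcess.measurable_integrand (hN : IsPoissonProcess N lam P) (B : Set ℕ) :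
    Measurable fun q : (Ω × ℝ≥0) × ℝ≥0 =>
      2 * ((N q.2 q.1.1 : ℝ≥0∞) * B.indicator 1 (N q.1.2 q.1.1)) := by
  have h1 : Measurable fun q : (Ω × ℝ≥0) × ℝ≥0 => (N q.2 q.1.1 : ℝ≥0∞) :=
    (measurable_of_countable (Nat.cast : ℕ → ℝ≥0∞)).comp
      (hN.measurable_uncurry.comp (measurable_snd.prodMk measurable_fst.fst))
  have h2 : Measurable fun q : (Ω × ℝ≥0) × ℝ≥0 => B.indicator (1 : ℕ → ℝ≥0∞) (N q.1.2 q.1.1) :=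
    (measurable_of_countable (B.indicator (1 : ℕ → ℝ≥0∞))).comp
      (hN.measurable_uncurry.comp (measurable_fst.snd.prodMk measurable_fst.fst))
  exact (h1.mul h2).const_mul 2

lemma IsPoissonProcess.measurable_inner (hN : IsPoissonProcess N lam P) (B : Set ℕ) :
    Measurable fun q : Ω × ℝ≥0 =>
      ∫⁻ s in Set.Iio q.2, 2 * ((N s q.1 : ℝ≥0∞) * B.indicator 1 (N q.2 q.1)) ∂timeMeasure := by
  have h := ((hN.measurable_integrand B).indicator
    (measurableSet_lt measurable_snd measurable_fst.snd)).lintegral_prod_right' (ν := timeMeasure)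
  convert h using 2 with q
  rw [← lintegral_indicator measurableSet_Iio]
  simp only [Set.indicator_apply, Set.mem_ofPred_eq, Set.mem_Iio]

lemma IsPoissonProcess.measurable_doubleWaiting (hN : IsPoissonProcess N lam P)
    (I : Set ℝ≥0) (B : Set ℕ) : Measurable (doubleWaiting N I B) :=
  (hN.measurable_inner B).lintegral_prod_right'

lemma setLIntegral_Iio_const_mul (c : ℝ≥0) (u : ℝ≥0) :
    ∫⁻ s in Set.Iio u, 2 * ((c * s : ℝ≥0) : ℝ≥0∞) ∂timeMeasure = (c * u ^ 2 : ℝ≥0) := by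
  have h := setLIntegral_Ico_timeMeasure 0 u (f := fun x => 2 * (c * x))
    (F := fun x => c * x ^ 2) (by fun_prop)
    (fun x => by simpa [mul_left_comm] using! (hasDerivAt_pow 2 x).const_mul (c : ℝ)) zero_le
    (fun x hx => by
      have : 0 ≤ x := hx
      positivity)
  have hI : Set.Ico 0 u = Set.Iio u := by ext; simp
  rw [hI] at h
  calc _ = _ := by
        refine lintegral_congr fun s => ?_
        rw [ENNReal.ofReal_mul zero_le_two, ENNReal.ofReal_ofNat, ← NNReal.coe_mul,
          ENNReal.ofReal_coe_nnreal]
    _ = _ := h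
    _ = _ := by
        rw [← ENNReal.ofReal_coe_nnreal]
        simp

lemma IsPoissonProcess.lintegral_doubleWaiting [IsProbabilityMeasure P]
    (hN : IsPoissonProcess N lam P) (I : Set ℝ≥0) (B : Set ℕ) :
    ∫⁻ ω, doubleWaiting N I B ω ∂P =
      ∫⁻ u in I, (lam * u ^ 2 : ℝ≥0) * poissonMeasure (lam * u) {n | n + 1 ∈ B} ∂timeMeasure := by
  simp only [doubleWaiting]
  rw [lintegral_lintegral_swap (hN.measurable_inner B).aemeasurable]
  refine lintegral_congr fun u => ?_
  have hm : Measurable fun q : Ω × ℝ≥0 =>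
      2 * ((N q.2 q.1 : ℝ≥0∞) * B.indicator 1 (N u q.1)) :=
    (hN.measurable_integrand B).comp
      ((measurable_fst.prodMk measurable_const).prodMk measurable_snd)
  rw [lintegral_lintegral_swap hm.aemeasurable, ← setLIntegral_Iio_const_mul,
    ← lintegral_mul_const' _ _ (measure_ne_top _ _)]
  refine setLIntegral_congr_fun measurableSet_Iio fun s hs => ?_
  rw [lintegral_const_mul' _ _ (by simp), hN.lintegral_mul (le_of_lt hs), mul_assoc,
    ← lintegral_indicator_one (MeasurableSet.of_discrete)]
  rfl

/-! ### Third falling factorials -/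

/-- Truncated subtraction is harmless: for `n = 0, 1` an earlier factor already vanishes. -/
lemma fallingThree_eq_natCast (n : ℕ) : fallingThree n = (n * ((n - 1) * (n - 2)) : ℕ) := by
  unfold fallingThree
  rcases n with _ | _ | n
  · simp
  · simp
  · have h1 : n + 1 + 1 - 1 = n + 1 := rfl
    have h2 : n + 1 + 1 - 2 = n := rfl
    rw [h1, h2]
    push_cast
    ring

lemma fallingThree_nonneg (n : ℕ) : 0 ≤ fallingThree n := by
  rw [fallingThree_eq_natCast]
  exact Nat.cast_nonneg _

lemma fallingThree_mono : Monotone fallingThree := fun a b hab => by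
  rw [fallingThree_eq_natCast, fallingThree_eq_natCast]
  gcongr

/-- Raising the cap from `j` to `j + 1` changes the value only if `n > j`, and then by `(j + 1) j (j
- 1) - j (j - 1) (j - 2) = 3 j (j - 1)`. -/
lemma fallingThree_min (n m : ℕ) :
    fallingThree (min n m) =
      ∑ j ∈ Finset.range m, 3 * ((j : ℝ) * (j - 1)) * (Set.Ioi j).indicator 1 n := by
  induction m with
  | zero => simp [fallingThree]
  | succ m ih =>
    rw [Finset.sum_range_succ, ← ih]
    rcases lt_or_ge m n with h | h
    · rw [min_eq_right h, min_eq_right h.le, Set.indicator_of_mem (Set.mem_Ioi.2 h)]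
      simp only [fallingThree, Pi.one_apply]
      push_cast
      ring
    · rw [min_eq_left h, min_eq_left (h.trans (Nat.le_succ m)),
        Set.indicator_of_notMem (by simpa using h)]
      ring

lemma sum_range_mul_pred (q : ℕ) :
    ∑ j ∈ Finset.range (q + 1), ((j : ℝ) * (j - 1)) = ((q : ℝ) ^ 3 - q) / 3 := by
  induction q with
  | zero => simp
  | succ q ih =>
    rw [Finset.sum_range_succ, ih]
    push_cast
    ring

section

variable {Ω' : Type*} [MeasurableSpace Ω'] {P' : Measure Ω'}
  {Y : Ω' → ℕ} {r : ℝ≥0}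

lemma integral_fallingThree_truncated (hY : HasLaw Y (poissonMeasure r) P') (m : ℕ) :
    ∫ ω, fallingThree (truncated Y m ω) ∂P' =
      3 * ∑ j ∈ Finset.range m, ((j : ℝ) * (j - 1)) * (poissonMeasure r).real (Set.Ioi j) := by
  have h := hY.integral_comp (f := fun n => fallingThree (min n m))
    (measurable_of_countable _).aestronglyMeasurable
  refine h.trans ?_
  simp_rw [fallingThree_min]
  rw [integral_finsetSum, Finset.mul_sum]
  · refine Finset.sum_congr rfl fun j _ => ?_
    rw [integral_const_mul, integral_indicator_one measurableSet_Ioi, mul_assoc]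
  · intro j _
    exact ((integrable_const (1 : ℝ)).indicator measurableSet_Ioi).const_mul _

/-- Each application of Chen-Stein removes one factor and contributes one `r`. -/
lemma lintegral_fallingThree (r : ℝ≥0) :
    ∫⁻ n, ENNReal.ofReal (fallingThree n) ∂poissonMeasure r = (r : ℝ≥0∞) ^ 3 := by
  have h (n : ℕ) : ENNReal.ofReal (fallingThree n) =
      (n : ℝ≥0∞) * (((n - 1 : ℕ) : ℝ≥0∞) * ((n - 2 : ℕ) : ℝ≥0∞)) := by
    rw [fallingThree_eq_natCast, ENNReal.ofReal_natCast]
    push_cast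
    rfl
  simp_rw [h]
  have h2 (n : ℕ) : n + 1 - 2 = n - 1 := rfl
  rw [lintegral_poissonMeasure_mul]
  simp only [Nat.add_sub_cancel, h2]
  rw [lintegral_poissonMeasure_mul]
  simp only [Nat.add_sub_cancel]
  have h3 := lintegral_poissonMeasure_mul r fun _ => 1
  simp only [mul_one, lintegral_one, measure_univ] at h3
  rw [h3]
  ring

lemma integrable_fallingThree (hY : HasLaw Y (poissonMeasure r) P') :
    Integrable (fun ω => fallingThree (Y ω)) P' := by
  have hm : AEMeasurable (fun ω => fallingThree (Y ω)) P' :=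
    (measurable_of_countable fallingThree).comp_aemeasurable hY.aemeasurable
  refine ⟨hm.aestronglyMeasurable, ?_⟩
  rw [hasFiniteIntegral_iff_ofReal (ae_of_all _ fun ω => fallingThree_nonneg _),
    hY.lintegral_comp (f := fun n => ENNReal.ofReal (fallingThree n))
      (measurable_of_countable _).aemeasurable, lintegral_fallingThree]
  exact ENNReal.pow_lt_top ENNReal.coe_lt_top

lemma integral_fallingThree (hY : HasLaw Y (poissonMeasure r) P') :
    ∫ ω, fallingThree (Y ω) ∂P' = (r : ℝ) ^ 3 := by
  rw [integral_eq_lintegral_of_nonneg_ae (ae_of_all _ fun ω => fallingThree_nonneg _)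
      (integrable_fallingThree hY).aestronglyMeasurable,
    hY.lintegral_comp (f := fun n => ENNReal.ofReal (fallingThree n))
      (measurable_of_countable _).aemeasurable, lintegral_fallingThree]
  simp

lemma tendsto_integral_fallingThree_truncated (hY : HasLaw Y (poissonMeasure r) P') :
    Tendsto (fun k : ℕ => ∫ ω, fallingThree (truncated Y (k + 1) ω) ∂P') atTop
      (𝓝 ((r : ℝ) ^ 3)) := by
  rw [← integral_fallingThree hY]
  refine tendsto_integral_of_dominated_convergence (fun ω => fallingThree (Y ω)) (fun k => ?_)
    (integrable_fallingThree hY) (fun k => ae_of_all _ fun ω => ?_) (ae_of_all _ fun ω => ?_)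
  · exact ((measurable_of_countable fun n => fallingThree (min n (k + 1))).comp_aemeasurable
      hY.aemeasurable).aestronglyMeasurable
  · rw [Real.norm_of_nonneg (fallingThree_nonneg _)]
    exact fallingThree_mono (min_le_left _ _)
  · refine tendsto_const_nhds.congr' ?_
    filter_upwards [eventually_ge_atTop (Y ω)] with k hk
    rw [truncated, min_eq_left (hk.trans (Nat.le_succ k))]

end

/-! ### Expected squared waiting -/

/-- With `r = λ u` the prefactor is `λ⁻¹ r²`. Each `r` is absorbed by a Chen-Stein shift: `r² P(X +
1 < q) = E[X (X - 1); X < q + 1]`. The second shift moves the cut-off to `q + 1`. -/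
lemma mul_poissonMeasure_Iio {lam : ℝ≥0} (hlam : 0 < lam) (u : ℝ≥0) (q : ℕ) :
    ((lam * u ^ 2 : ℝ≥0) : ℝ≥0∞) * poissonMeasure (lam * u) {n | n + 1 ∈ Set.Iio q} =
      ∑ n ∈ Finset.range (q + 1), (lam : ℝ≥0∞)⁻¹ * ((n * (n - 1) : ℕ) : ℝ≥0∞) *
        poissonMeasure (lam * u) {n} := by
  have hl : (lam : ℝ≥0∞) ≠ 0 := by exact_mod_cast hlam.ne'
  set r := lam * u with hr
  have h1 := lintegral_poissonMeasure_mul r fun n =>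
    ((n - 1 : ℕ) : ℝ≥0∞) * (Set.Iio (q + 1)).indicator 1 n
  have h2 := lintegral_poissonMeasure_mul r fun n => (Set.Iio (q + 1)).indicator 1 (n + 1)
  have hset : (fun n => (Set.Iio (q + 1)).indicator (1 : ℕ → ℝ≥0∞) (n + 1 + 1)) =
      {n | n + 1 ∈ Set.Iio q}.indicator 1 := by
    ext n
    simp [Set.indicator_apply]
  simp only [Nat.add_sub_cancel] at h1
  rw [hset, lintegral_indicator_one .of_discrete] at h2
  rw [h2, lintegral_poissonMeasure, tsum_eq_sum (s := Finset.range (q + 1))] at h1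
  · have hmul : (lam : ℝ≥0∞)⁻¹ * (r * (r * poissonMeasure r {n | n + 1 ∈ Set.Iio q})) =
        ((lam * u ^ 2 : ℝ≥0) : ℝ≥0∞) * poissonMeasure r {n | n + 1 ∈ Set.Iio q} := by
      rw [← mul_assoc, ← mul_assoc]
      congr 1
      rw [hr]
      push_cast
      calc _ = ((lam : ℝ≥0∞)⁻¹ * lam) * (lam * u ^ 2) := by ring
        _ = _ := by rw [ENNReal.inv_mul_cancel hl ENNReal.coe_ne_top, one_mul]
    rw [← hmul, ← h1, Finset.mul_sum]
    refine Finset.sum_congr rfl fun n hn => ?_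
    rw [Set.indicator_of_mem (by simpa using hn)]
    push_cast
    simp only [Pi.one_apply]
    ring
  · intro n hn
    rw [Set.indicator_of_notMem (by simpa using hn)]
    simp

lemma measurable_poissonMeasure_singleton (lam : ℝ≥0) (n : ℕ) :
    Measurable fun u : ℝ≥0 => poissonMeasure (lam * u) {n} := by
  simp_rw [poissonMeasure_singleton]
  fun_prop

lemma IsPoissonProcess.lintegral_doubleWaiting_Iio [IsProbabilityMeasure P]
    (hN : IsPoissonProcess N lam P)
    (hlam : 0 < lam) (I : Set ℝ≥0) (q : ℕ) :
    ∫⁻ ω, doubleWaiting N I (Set.Iio q) ω ∂P =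
      ∑ n ∈ Finset.range (q + 1), (lam : ℝ≥0∞)⁻¹ * ((n * (n - 1) : ℕ) : ℝ≥0∞) *
        ∫⁻ u in I, poissonMeasure (lam * u) {n} ∂timeMeasure := by
  rw [hN.lintegral_doubleWaiting]
  simp_rw [mul_poissonMeasure_Iio hlam]
  have hm := measurable_poissonMeasure_singleton lam
  rw [lintegral_finsetSum _ fun n _ => (hm n).const_mul _]
  exact Finset.sum_congr rfl fun n _ => lintegral_const_mul _ (hm n)

/-- Common reduction for the three policies: a policy enters only through the sets `I` and `B` that
describe `u < σ`. -/
lemma IsPoissonProcess.integral_squaredWaiting (hN : IsPoissonProcess N lam P)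
    {σ : Ω → WithTop ℝ≥0} {I : Set ℝ≥0} {B : Set ℕ} (hσ : ∀ᵐ ω ∂P, σ ω ≠ ⊤)
    (h : ∀ ω (u : ℝ≥0), (u : WithTop ℝ≥0) < σ ω ↔ u ∈ I ∧ N u ω ∈ B)
    (hfin : ∫⁻ ω, doubleWaiting N I B ω ∂P ≠ ⊤) :
    Integrable (squaredWaiting hN.path σ) P ∧
      ∫ ω, squaredWaiting hN.path σ ω ∂P = (∫⁻ ω, doubleWaiting N I B ω ∂P).toReal := by
  have hm := hN.measurable_doubleWaiting I B
  have hae : (fun ω => (doubleWaiting N I B ω).toReal) =ᵐ[P] squaredWaiting hN.path σ := by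
    filter_upwards [hσ] with ω hω
    rw [squaredWaiting_eq_toReal hN.path σ ω hω]
    have hA : MeasurableSet {u : ℝ≥0 | N u ω ∈ B} :=
      (hN.measurable_uncurry.comp measurable_prodMk_right) (MeasurableSet.of_discrete (s := B))
    have hset : {u : ℝ≥0 | (u : WithTop ℝ≥0) < σ ω} = {u : ℝ≥0 | N u ω ∈ B} ∩ I := by
      ext u
      rw [Set.mem_ofPred_eq, h, and_comm]
      rfl
    rw [hset, ← Measure.restrict_restrict hA, ← lintegral_indicator hA, doubleWaiting]
    congr 1
    refine lintegral_congr fun u => ?_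
    by_cases hu : N u ω ∈ B
    · simp [hu]
    · simp [hu]
  exact ⟨(integrable_toReal_of_lintegral_ne_top hm.aemeasurable hfin).congr hae,
    (integral_congr_ae hae).symm.trans
      (integral_toReal hm.aemeasurable (ae_lt_top hm hfin))⟩

lemma IsPoissonProcess.squaredWaiting_cycleHP [IsProbabilityMeasure P]
    (hN : IsPoissonProcess N lam P) (hlam : 0 < lam)
    (q : ℕ) (T : ℝ≥0) :
    Integrable (squaredWaiting hN.path (cycleHP N q T)) P ∧
      ∫ ω, squaredWaiting hN.path (cycleHP N q T) ω ∂P =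
        (∑ j ∈ Finset.range (q + 1),
          ((j : ℝ) * (j - 1)) * (poissonMeasure (lam * T)).real (Set.Ioi j)) / (lam : ℝ) ^ 2 := by
  have hl : (lam : ℝ≥0∞) ≠ 0 := by exact_mod_cast hlam.ne'
  have hE := hN.lintegral_doubleWaiting_Iio hlam (Set.Iio T) q
  simp_rw [setLIntegral_poissonMeasure_singleton hlam] at hE
  have hne (n : ℕ) : (lam : ℝ≥0∞)⁻¹ * ((n * (n - 1) : ℕ) : ℝ≥0∞) *
      ((lam : ℝ≥0∞)⁻¹ * poissonMeasure (lam * T) (Set.Ioi n)) ≠ ⊤ := by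
    finiteness
  have h := hN.integral_squaredWaiting (σ := cycleHP N q T) (I := Set.Iio T) (B := Set.Iio q)
    (ae_of_all _ fun ω => ne_top_of_le_ne_top WithTop.coe_ne_top (min_le_right _ _))
    (fun ω u => by
      rw [cycleHP, lt_min_iff, coe_lt_hittingTime_iff hN.path, WithTop.coe_lt_coe, and_comm]
      rfl)
    (by rw [hE]; exact ENNReal.sum_ne_top.2 fun n _ => hne n)
  refine ⟨h.1, h.2.trans ?_⟩
  rw [hE, ENNReal.toReal_sum fun n _ => hne n, Finset.sum_div]
  refine Finset.sum_congr rfl fun n _ => ?_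
  simp only [ENNReal.toReal_mul, ENNReal.toReal_inv, ENNReal.coe_toReal, ENNReal.toReal_natCast,
    Measure.real]
  -- The case `n = 0` is separated because `n - 1` is truncated in `ℕ` on one side and real on the
  -- other.
  rcases n with _ | n
  · simp
  · have : (lam : ℝ) ≠ 0 := by exact_mod_cast hlam.ne'
    simp only [Nat.add_sub_cancel]
    push_cast
    field_simp
    ring

/-- If level `q` is never reached then `N(S) ≤ q` for every `S`, an event whose probability tends to
`0`. -/
lemma IsPoissonProcess.cycleQP_ne_top (hN : IsPoissonProcess N lam P) (hlam : 0 < lam) (q : ℕ) :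
    ∀ᵐ ω ∂P, cycleQP N q ω ≠ ⊤ := by
  rw [ae_iff]
  have hle (S : ℝ≥0) : P {ω | ¬cycleQP N q ω ≠ ⊤} ≤
      1 - poissonMeasure (lam * S) (Set.Ioi q) := by
    rw [← prob_compl_eq_one_sub measurableSet_Ioi, ← (hN.hasLaw S).map_eq,
      Measure.map_apply (hN.measurable S) measurableSet_Ioi.compl]
    refine measure_mono fun ω hω => ?_
    have htop : cycleQP N q ω = ⊤ := not_not.1 hω
    have := (coe_lt_hittingTime_iff hN.path q ω S).1
      (by rw [show hittingTime N q ω = ⊤ from htop]; exact WithTop.coe_lt_top S)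
    simpa using this.le
  have hlim : Tendsto (fun S : ℝ≥0 => 1 - poissonMeasure (lam * S) (Set.Ioi q)) atTop (𝓝 0) := by
    simpa using ENNReal.Tendsto.sub (tendsto_const_nhds (x := 1))
      (tendsto_poissonMeasure_Ioi hlam q) (Or.inl ENNReal.one_ne_top)
  exact le_antisymm (ge_of_tendsto' hlim hle) zero_le

lemma IsPoissonProcess.squaredWaiting_cycleQP [IsProbabilityMeasure P]
    (hN : IsPoissonProcess N lam P) (hlam : 0 < lam)
    (q : ℕ) :
    Integrable (squaredWaiting hN.path (cycleQP N q)) P ∧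
      ∫ ω, squaredWaiting hN.path (cycleQP N q) ω ∂P =
        ((q : ℝ) ^ 3 - (q : ℝ)) / (3 * (lam : ℝ) ^ 2) := by
  have hl : (lam : ℝ≥0∞) ≠ 0 := by exact_mod_cast hlam.ne'
  have hE := hN.lintegral_doubleWaiting_Iio hlam Set.univ q
  simp_rw [setLIntegral_univ, lintegral_poissonMeasure_singleton hlam] at hE
  have hne (n : ℕ) : (lam : ℝ≥0∞)⁻¹ * ((n * (n - 1) : ℕ) : ℝ≥0∞) * (lam : ℝ≥0∞)⁻¹ ≠ ⊤ := by
    finiteness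
  have h := hN.integral_squaredWaiting (σ := cycleQP N q) (I := Set.univ) (B := Set.Iio q)
    (hN.cycleQP_ne_top hlam q)
    (fun ω u => by
      rw [cycleQP, coe_lt_hittingTime_iff hN.path]
      simp)
    (by rw [hE]; exact ENNReal.sum_ne_top.2 fun n _ => hne n)
  refine ⟨h.1, h.2.trans ?_⟩
  rw [hE, ENNReal.toReal_sum fun n _ => hne n, ← div_div, ← sum_range_mul_pred, Finset.sum_div]
  refine Finset.sum_congr rfl fun n _ => ?_
  simp only [ENNReal.toReal_mul, ENNReal.toReal_inv, ENNReal.coe_toReal, ENNReal.toReal_natCast]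
  rcases n with _ | n
  · simp
  · have : (lam : ℝ) ≠ 0 := by exact_mod_cast hlam.ne'
    simp only [Nat.add_sub_cancel]
    push_cast
    field_simp
    ring

/-- There is no constraint on `N(u)`, so the mean is simply `∫_0^T λ u² du`. -/
lemma IsPoissonProcess.squaredWaiting_cycleTP [IsProbabilityMeasure P]
    (hN : IsPoissonProcess N lam P) (T : ℝ≥0) :
    Integrable (squaredWaiting hN.path (cycleTP T)) P ∧
      ∫ ω, squaredWaiting hN.path (cycleTP T) ω ∂P = (lam : ℝ) * (T : ℝ) ^ 3 / 3 := by
  have hE : ∫⁻ ω, doubleWaiting N (Set.Iio T) Set.univ ω ∂P =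
      ENNReal.ofReal ((lam : ℝ) * (T : ℝ) ^ 3 / 3) := by
    have h := setLIntegral_Ico_timeMeasure 0 T (f := fun x => lam * x ^ 2)
      (F := fun x => lam * x ^ 3 / 3) (by fun_prop)
      (fun x => (((hasDerivAt_pow 3 x).const_mul (lam : ℝ)).div_const 3).congr_deriv
        (by norm_num; ring)) zero_le (fun x _ => by positivity)
    have hI : Set.Ico 0 T = Set.Iio T := by ext; simp
    rw [hI, NNReal.coe_zero, zero_pow three_ne_zero, mul_zero, zero_div, sub_zero] at h
    rw [hN.lintegral_doubleWaiting, ← h]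
    refine lintegral_congr fun u => ?_
    rw [← NNReal.coe_pow, ← NNReal.coe_mul, ENNReal.ofReal_coe_nnreal]
    simp
  have h := hN.integral_squaredWaiting (σ := cycleTP T) (I := Set.Iio T) (B := Set.univ)
    (ae_of_all _ fun ω => WithTop.coe_ne_top)
    (fun ω u => by
      rw [cycleTP, WithTop.coe_lt_coe]
      simp)
    (by rw [hE]; exact ENNReal.ofReal_ne_top)
  refine ⟨h.1, h.2.trans ?_⟩
  rw [hE, ENNReal.toReal_ofReal (by positivity)]

end Consolidation

end

theorem mainTheorem7
    {Ω : Type*} [MeasurableSpace Ω] (P : Measure Ω) [IsProbabilityMeasure P]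
    (N : ℝ≥0 → Ω → ℕ) (lam : ℝ≥0) (hlam : 0 < lam)
    (hN : Consolidation.IsPoissonProcess N lam P)
    (q : ℕ) (hq : 1 ≤ q) (T : ℝ≥0) (hT : 0 < T)
    {Ω' : Type*} [MeasurableSpace Ω'] (P' : Measure Ω') [IsProbabilityMeasure P']
    (Y : Ω' → ℕ) (hY : HasLaw Y (poissonMeasure (lam * T)) P') :
    -- hybrid policy
    (Integrable (Consolidation.squaredWaiting hN.path (Consolidation.cycleHP N q T)) P ∧
      ∫ ω, Consolidation.squaredWaiting hN.path (Consolidation.cycleHP N q T) ω ∂P =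
        (∫ ω, Consolidation.fallingThree (Consolidation.truncated Y (q + 1) ω) ∂P') /
          (3 * (lam : ℝ) ^ 2)) ∧
    -- quantity-based policy, also as the limit of the hybrid policy when the time tends to infinity
    ((∀ᵐ ω ∂P, Consolidation.cycleQP N q ω ≠ ⊤) ∧
      Integrable (Consolidation.squaredWaiting hN.path (Consolidation.cycleQP N q)) P ∧
      ∫ ω, Consolidation.squaredWaiting hN.path (Consolidation.cycleQP N q) ω ∂P =
        ((q : ℝ) ^ 3 - (q : ℝ)) / (3 * (lam : ℝ) ^ 2) ∧
      Tendsto (fun S : ℝ≥0 =>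
          ∫ ω, Consolidation.squaredWaiting hN.path (Consolidation.cycleHP N q S) ω ∂P)
        atTop (𝓝 (((q : ℝ) ^ 3 - (q : ℝ)) / (3 * (lam : ℝ) ^ 2)))) ∧
    -- time-based policy, also as the limit of the hybrid policy when the quantity tends to infinity
    (Integrable (Consolidation.squaredWaiting hN.path (Consolidation.cycleTP T)) P ∧
      ∫ ω, Consolidation.squaredWaiting hN.path (Consolidation.cycleTP T) ω ∂P =
        (∫ ω, Consolidation.fallingThree (Y ω) ∂P') / (3 * (lam : ℝ) ^ 2) ∧
      (∫ ω, Consolidation.fallingThree (Y ω) ∂P') / (3 * (lam : ℝ) ^ 2) =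
        (lam : ℝ) * (T : ℝ) ^ 3 / 3 ∧
      Tendsto (fun k : ℕ =>
          ∫ ω, Consolidation.squaredWaiting hN.path (Consolidation.cycleHP N k T) ω ∂P)
        atTop (𝓝 ((lam : ℝ) * (T : ℝ) ^ 3 / 3))) := by
  have hl : (lam : ℝ) ≠ 0 := by exact_mod_cast hlam.ne'
  have hHP (k : ℕ) : ∫ ω, Consolidation.squaredWaiting hN.path (Consolidation.cycleHP N k T) ω ∂P =
      (∫ ω, Consolidation.fallingThree (Consolidation.truncated Y (k + 1) ω) ∂P') /
        (3 * (lam : ℝ) ^ 2) := by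
    rw [(hN.squaredWaiting_cycleHP hlam k T).2, Consolidation.integral_fallingThree_truncated hY,
      mul_div_mul_left _ _ three_ne_zero]
  have hcube : (((lam * T : ℝ≥0) : ℝ) ^ 3) / (3 * (lam : ℝ) ^ 2) = (lam : ℝ) * (T : ℝ) ^ 3 / 3 := by
    push_cast
    field_simp
  refine ⟨⟨(hN.squaredWaiting_cycleHP hlam q T).1, hHP q⟩,
    ⟨hN.cycleQP_ne_top hlam q, (hN.squaredWaiting_cycleQP hlam q).1,
      (hN.squaredWaiting_cycleQP hlam q).2, ?_⟩,
    ⟨(hN.squaredWaiting_cycleTP T).1, ?_, ?_, ?_⟩⟩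
  -- The sum over `j ≤ q` is finite and each tail probability tends to `1`, so the limit is taken
  -- termwise.
  · simp_rw [(hN.squaredWaiting_cycleHP hlam q _).2]
    rw [← div_div, ← Consolidation.sum_range_mul_pred]
    refine Tendsto.div_const (tendsto_finsetSum _ fun j _ => ?_) _
    have h := (ENNReal.tendsto_toReal ENNReal.one_ne_top).comp
      (Consolidation.tendsto_poissonMeasure_Ioi hlam j)
    simpa [Measure.real, Function.comp_def] using h.const_mul ((j : ℝ) * (j - 1))
  · rw [(hN.squaredWaiting_cycleTP T).2, Consolidation.integral_fallingThree hY, hcube]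
  · rw [Consolidation.integral_fallingThree hY, hcube]
  · simp_rw [hHP]
    rw [← hcube]
    exact (Consolidation.tendsto_integral_fallingThree_truncated hY).div_const _
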